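/- Let $G$ be an additive discrete abelian group generated by one element $e$ (so $G\cong\mathbb Z$ or $G\cong\mathbb Z/m\mathbb Z$), let $N$ be a natural number, and let $e_i\in G^N$ be the element with $e$ in the $i$-th coordinate and $0$ in the others. For $f:G^N\to\mathbb C$ put $$\partial^i_+f(n)=f(n+e_i)-f(n),\qquad \partial^i_-f(n)=f(n)-f(n-e_i),\qquad \Delta=\sum_{i=1}^N\partial^i_+\partial^i_-,$$ and let $\tilde f(\cdot,t)=e^{t\Delta}f$, $t\ge 0$, be the heat extension of $f$. Let $1<p,q<\infty$ with $\frac1p+\frac1q=1$, let $p^*=\max\{p,q\}$, and let $\|f\|_p=\big(\sum_{n\in G^N}|f(n)|^p\big)^{1/p}$. Then for all test functions (that is, finitely supported functions) $f,g:G^N\to\mathbb C$, $$2\sum_{i=1}^N\int_0^\infty\sum_{n\in G^N}|\partial^i_+\tilde f(n,t)|\,|\partial^i_+\tilde g(n,t)|\,dt\ \le\ (p^*-1)\,\|f\|_p\,\|g\|_q .$$ -/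

import Mathlib

open scoped ENNReal Nat

noncomputable section

variable {G : Type*} [AddCommGroup G] {N : ℕ}

/-- Right-hand derivative in direction `i` on `G^N`, where `e` is the chosen generator of `G`:
`∂₊ⁱ f (n) = f (n + eᵢ) - f n`. -/
def rightDeriv (e : G) (i : Fin N) (f : (Fin N → G) → ℂ) : (Fin N → G) → ℂ :=
  fun n => f (n + Pi.single i e) - f n

/-- Left-hand derivative in direction `i` on `G^N`: `∂₋ⁱ f (n) = f n - f (n - eᵢ)`. -/
def leftDeriv (e : G) (i : Fin N) (f : (Fin N → G) → ℂ) : (Fin N → G) → ℂ :=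
  fun n => f n - f (n - Pi.single i e)

/-- The discrete Laplacian `Δ = ∑ᵢ ∂₊ⁱ ∂₋ⁱ` on `G^N`. -/
def discreteLaplacian (e : G) (f : (Fin N → G) → ℂ) : (Fin N → G) → ℂ :=
  fun n => ∑ i : Fin N, rightDeriv e i (leftDeriv e i f) n

/-- The heat extension `f̃ (n, t) = (e^{tΔ} f) (n)`, given by the exponential series
`∑ₖ tᵏ / k! · (Δᵏ f) (n)`, which converges absolutely for every bounded `f`
(see `summable_heatExtension`). -/
def heatExtension (e : G) (f : (Fin N → G) → ℂ) (n : Fin N → G) (t : ℝ) : ℂ :=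
  ∑' k : ℕ, ((t : ℂ) ^ k / (k ! : ℂ)) * ((discreteLaplacian e)^[k] f) n

/-- The `ℓ^p` norm on `G^N` with respect to counting measure, with values in `[0, ∞]`. -/
def ellNorm (p : ℝ) (f : (Fin N → G) → ℂ) : ℝ≥0∞ :=
  (∑' n : Fin N → G, ‖f n‖ₑ ^ p) ^ (1 / p)

theorem norm_discreteLaplacian_le (e : G) (f : (Fin N → G) → ℂ) (C : ℝ)
    (hf : ∀ n, ‖f n‖ ≤ C) (n : Fin N → G) : ‖discreteLaplacian e f n‖ ≤ (4 * N) * C := by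
  have key : ∀ i ∈ (Finset.univ : Finset (Fin N)),
      ‖rightDeriv e i (leftDeriv e i f) n‖ ≤ 4 * C := by
    intro i _
    have h : ∀ m, ‖leftDeriv e i f m‖ ≤ 2 * C := fun m => by
      have := norm_sub_le (f m) (f (m - Pi.single i e))
      have h1 := hf m
      have h2 := hf (m - Pi.single i e)
      unfold leftDeriv
      linarith
    have h0 := norm_sub_le (leftDeriv e i f (n + Pi.single i e)) (leftDeriv e i f n)
    have h1 := h n
    have h2 := h (n + Pi.single i e)
    unfold rightDeriv
    linarith
  have := norm_sum_le_of_le _ key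
  simp only [Finset.sum_const, Finset.card_univ, Fintype.card_fin, nsmul_eq_mul] at this
  unfold discreteLaplacian
  linarith

/-- The series defining the heat extension of a bounded function converges absolutely. -/
theorem summable_heatExtension (e : G) (f : (Fin N → G) → ℂ) (C : ℝ)
    (hf : ∀ n, ‖f n‖ ≤ C) (n : Fin N → G) (t : ℝ) :
    Summable fun k : ℕ => ‖((t : ℂ) ^ k / (k ! : ℂ)) * ((discreteLaplacian e)^[k] f) n‖ := by
  have hb : ∀ (k : ℕ) (m : Fin N → G),
      ‖((discreteLaplacian e)^[k] f) m‖ ≤ (4 * N : ℝ) ^ k * C := by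
    intro k
    induction k with
    | zero => simpa using hf
    | succ k ih =>
      intro m
      rw [Function.iterate_succ_apply']
      refine (norm_discreteLaplacian_le e _ _ ih m).trans (le_of_eq ?_)
      ring
  refine Summable.of_nonneg_of_le (fun _ => norm_nonneg _) (fun k => ?_)
    ((Real.summable_pow_div_factorial (|t| * (4 * N))).mul_right C)
  rw [norm_mul, norm_div, norm_pow, Complex.norm_real, Complex.norm_natCast, Real.norm_eq_abs]
  calc |t| ^ k / (k ! : ℝ) * ‖((discreteLaplacian e)^[k] f) n‖
      ≤ |t| ^ k / (k ! : ℝ) * ((4 * N : ℝ) ^ k * C) := by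
        gcongr
        exact hb k n
    _ = (|t| * (4 * N)) ^ k / (k ! : ℝ) * C := by
        rw [mul_pow]
        ring

end

/-!
The proof is a Bellman function argument. By the symmetry between `(f, p)` and `(g, q)` one may
assume `p ≥ 2`, so that the constant is `p - 1`.

*The Bellman function.* Let `U(x, z) = (|z| - (p - 1)|x|) (|x| + |z|) ^ (p - 1)` be Burkholder's
function. Up to the factor `p ^ (1 - p)`, it dominates a difference of `p`-th powers
(`rpow_sub_le_burkholder`), and it lies below its tangent plane along all increments `(h, k)` with
`|k| = |h|` (`burkholder_zigzag`). Its Legendre transform in the second argument,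
`Φ(x, y) = max_z (⟪z, y⟫ - p ^ (1 - p) U(x, z))`, satisfies
`0 ≤ Φ(x, y) ≤ (p - 1) (|x| ^ p / p + |y| ^ q / q)`, and it has a gain of convexity: if `z` is a
maximiser for `(x, y)`, then testing `Φ(x + h, y + k')` with `z + k`, where `|k| = |h|` and `k`
points in the direction of `k'`, produces an affine minorant touching `Φ` at `(x, y)` and an additional
term `⟪k, k'⟫ = |h| |k'|` (`exists_bellman`).

*The flow.* An Euler step `1 + ε Δ` with `2 N ε ≤ 1` averages over neighbours. Jensen's inequality
with the gain therefore bounds the gain of one step by the decrease of `∑ₙ Φ(f n, g n)`, and the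
decreases telescope (`IsConvexWithGain.tsum_stepGain_le`). The Euler scheme converges pointwise to
the heat extension (`tendsto_heatStep_iterate`, by the binomial formula and dominated convergence),
so Fatou's lemma turns the sum over the steps into the space-time integral
(`IsConvexWithGain.sum_lintegral_le`). Each difference `f(n + eᵢ) - f(n)` is seen from both of its
ends, which accounts for the factor `2`.

Normalising `f` and `g` in `ℓ^p` and `ℓ^q` turns `1 / p + 1 / q = 1` into the product of the norms.
-/

open Filter Topology MeasureTheory

/-! ### Elementary inequalities for powers -/

theorem rpow_sub_one_eq_mul {p u : ℝ} (hp : 2 ≤ p) (hu : 0 ≤ u) :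
    u ^ (p - 1) = u ^ (p - 2) * u := by
  rw [show p - 1 = (p - 2) + 1 by ring]
  exact Real.rpow_add_one' hu (by linarith)

theorem rpow_eq_mul_sq {p u : ℝ} (hp : 2 ≤ p) (hu : 0 ≤ u) :
    u ^ p = u ^ (p - 2) * u ^ 2 := by
  rw [show p = (p - 2) + (2 : ℕ) by push_cast; ring, Real.rpow_add_natCast' hu]
  · simp
  · push_cast; linarith

/-- The graph of `v ↦ v ^ (p - 1)` lies above its tangent line at `u`. The case `u = 0` is included;
there the slope is `0`, or `1` if `p = 2`, by the convention `0 ^ 0 = 1`. -/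
theorem rpow_tangent_le {p u v : ℝ} (hp : 2 ≤ p) (hu : 0 ≤ u) (hv : 0 ≤ v) :
    u ^ (p - 1) + (p - 1) * u ^ (p - 2) * (v - u) ≤ v ^ (p - 1) := by
  rcases hu.eq_or_lt with rfl | hu
  · rw [Real.zero_rpow (by linarith : p - 1 ≠ 0)]
    rcases hp.eq_or_lt with rfl | hp
    · norm_num
    · rw [Real.zero_rpow (by linarith : p - 2 ≠ 0)]
      simpa using Real.rpow_nonneg hv _
  · have h := one_add_mul_self_le_rpow_one_add (s := v / u - 1) (p := p - 1)
      (by linarith [div_nonneg hv hu.le]) (by linarith)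
    rw [add_sub_cancel, Real.div_rpow hv hu.le, le_div_iff₀ (by positivity)] at h
    refine le_trans (le_of_eq ?_) h
    rw [rpow_sub_one_eq_mul hp hu.le]
    field_simp

/-- The second-order Taylor polynomial of `t ↦ t ^ p` at `u` lies above the function to the left
of `u`. -/
theorem rpow_le_taylor_two {p u v : ℝ} (hp : 2 ≤ p) (hv : 0 ≤ v) (huv : v ≤ u) :
    v ^ p ≤ u ^ p + p * u ^ (p - 1) * (v - u) + p * (p - 1) / 2 * u ^ (p - 2) * (v - u) ^ 2 := by
  have hu : 0 ≤ u := hv.trans huv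
  set F : ℝ → ℝ := fun t =>
    u ^ p + p * u ^ (p - 1) * (t - u) + p * (p - 1) / 2 * u ^ (p - 2) * (t - u) ^ 2 - t ^ p with hF
  have hd : ∀ t, HasDerivAt F (p * (u ^ (p - 1) + (p - 1) * u ^ (p - 2) * (t - u)
      - t ^ (p - 1))) t := by
    intro t
    have h1 := (hasDerivAt_id t).sub_const u
    have h2 := Real.hasDerivAt_rpow_const (x := t) (p := p) (Or.inr (by linarith))
    refine ((((h1.const_mul (p * u ^ (p - 1))).const_add (u ^ p)).add
      ((h1.pow 2).const_mul (p * (p - 1) / 2 * u ^ (p - 2)))).sub h2).congr_deriv ?_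
    simp
    ring
  have hanti : AntitoneOn F (Set.Ici 0) := by
    refine antitoneOn_of_deriv_nonpos (convex_Ici 0)
      (fun t _ => (hd t).continuousAt.continuousWithinAt)
      (fun t _ => (hd t).differentiableAt.differentiableWithinAt) fun t ht => ?_
    rw [interior_Ici] at ht
    rw [(hd t).deriv]
    exact mul_nonpos_of_nonneg_of_nonpos (by linarith)
      (by linarith [rpow_tangent_le hp hu (le_of_lt ht : (0 : ℝ) ≤ t)])
  have := hanti (show (0 : ℝ) ≤ v from hv) (show (0 : ℝ) ≤ u from hu) huv
  simp only [hF] at this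
  simp at this
  linarith

/-- The trapezoidal rule overestimates the integral of the convex function `t ↦ t ^ (p - 1)`. -/
theorem rpow_sub_rpow_le_trapezoid {p u v : ℝ} (hp : 2 ≤ p) (hu : 0 ≤ u) (huv : u ≤ v) :
    v ^ p - u ^ p ≤ p / 2 * (v - u) * (u ^ (p - 1) + v ^ (p - 1)) := by
  have hv : 0 ≤ v := hu.trans huv
  set F : ℝ → ℝ := fun t => p / 2 * (t - u) * (u ^ (p - 1) + t ^ (p - 1)) - t ^ p with hF
  have hd : ∀ t, HasDerivAt F (p / 2 * (u ^ (p - 1) + t ^ (p - 1)) +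
      p / 2 * (t - u) * ((p - 1) * t ^ (p - 2)) - p * t ^ (p - 1)) t := by
    intro t
    have h1 := ((hasDerivAt_id t).sub_const u).const_mul (p / 2)
    have h2 := Real.hasDerivAt_rpow_const (x := t) (p := p) (Or.inr (by linarith))
    have h3 := Real.hasDerivAt_rpow_const (x := t) (p := p - 1) (Or.inr (by linarith))
    refine ((h1.mul (h3.const_add (u ^ (p - 1)))).sub h2).congr_deriv ?_
    rw [show p - 1 - 1 = p - 2 by ring]
    simp
  have hmono : MonotoneOn F (Set.Ici 0) := by
    refine monotoneOn_of_deriv_nonneg (convex_Ici 0)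
      (fun t _ => (hd t).continuousAt.continuousWithinAt)
      (fun t _ => (hd t).differentiableAt.differentiableWithinAt) fun t ht => ?_
    rw [interior_Ici] at ht
    rw [(hd t).deriv]
    have := rpow_tangent_le hp (le_of_lt ht : (0 : ℝ) ≤ t) hu
    nlinarith
  have := hmono (show (0 : ℝ) ≤ u from hu) (show (0 : ℝ) ≤ v from hv) huv
  simp only [hF] at this
  simp at this
  linarith

/-! ### Burkholder's function -/

/-- Burkholder's function (up to a constant factor) for `p ≥ 2`, in the moduli `r`, `s` of its two
arguments. -/
noncomputable def burkholder (p r s : ℝ) : ℝ := (s - (p - 1) * r) * (r + s) ^ (p - 1)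

/-- The difference of the two sides has derivative
`p (1 - d) ((1 - d / p) ^ (p - 2) - (1 - d) ^ (p - 2))`, which has the sign of `d`; equality holds
at `d = 0`. -/
theorem one_sub_rpow_le {p d : ℝ} (hp : 2 ≤ p) (hd : d ≤ 1) :
    1 - (1 - d) ^ p ≤ p * d * (1 - d / p) ^ (p - 1) := by
  have hp0 : 0 < p := by linarith
  set F : ℝ → ℝ := fun t => p * t * (1 - t / p) ^ (p - 1) + (1 - t) ^ p with hF
  have hdiv : ∀ t ≤ (1 : ℝ), 0 ≤ 1 - t / p := by
    intro t ht
    rw [sub_nonneg, div_le_one hp0]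
    linarith
  have hder : ∀ t ≤ (1 : ℝ), HasDerivAt F
      (p * (1 - t) * ((1 - t / p) ^ (p - 2) - (1 - t) ^ (p - 2))) t := by
    intro t ht
    have h1 := (hasDerivAt_id t).const_mul p
    have h2 := (((hasDerivAt_id t).div_const p).const_sub 1).rpow_const (p := p - 1)
      (Or.inr (by linarith))
    have h3 := ((hasDerivAt_id t).const_sub 1).rpow_const (p := p) (Or.inr (by linarith))
    refine ((h1.mul h2).add h3).congr_deriv ?_
    simp only [id]
    rw [show p - 1 - 1 = p - 2 by ring, rpow_sub_one_eq_mul hp (hdiv t ht),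
      rpow_sub_one_eq_mul hp (by linarith : (0 : ℝ) ≤ 1 - t)]
    field_simp
    ring
  have key : F 0 ≤ F d := by
    rcases le_total 0 d with h0 | h0
    · have hm : MonotoneOn F (Set.Icc 0 1) := by
        refine monotoneOn_of_deriv_nonneg (convex_Icc 0 1)
          (fun t ht => (hder t ht.2).continuousAt.continuousWithinAt)
          (fun t ht => (hder t (interior_subset ht).2).differentiableAt.differentiableWithinAt)
          fun t ht => ?_
        have ht := interior_subset ht
        rw [(hder t ht.2).deriv]
        refine mul_nonneg (mul_nonneg hp0.le (by linarith [ht.2])) (sub_nonneg.2 ?_)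
        exact Real.rpow_le_rpow (by linarith [ht.2])
          (by linarith [div_le_self ht.1 (by linarith : (1 : ℝ) ≤ p)]) (by linarith)
      exact hm ⟨le_rfl, zero_le_one⟩ ⟨h0, hd⟩ h0
    · have hm : AntitoneOn F (Set.Iic 0) := by
        have h1 : ∀ t ∈ Set.Iic (0 : ℝ), t ≤ 1 := fun t ht => le_trans ht zero_le_one
        refine antitoneOn_of_deriv_nonpos (convex_Iic 0)
          (fun t ht => (hder t (h1 t ht)).continuousAt.continuousWithinAt)
          (fun t ht =>
            (hder t (h1 t (interior_subset ht))).differentiableAt.differentiableWithinAt)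
          fun t ht => ?_
        have ht : t ∈ Set.Iic 0 := interior_subset ht
        rw [Set.mem_Iic] at ht
        rw [(hder t (h1 t ht)).deriv]
        refine mul_nonpos_of_nonneg_of_nonpos (mul_nonneg hp0.le (by linarith)) (sub_nonpos.2 ?_)
        refine Real.rpow_le_rpow (hdiv t (h1 t ht)) ?_ (by linarith)
        have : t ≤ t / p := by
          rw [le_div_iff₀ hp0]
          nlinarith
        linarith
      exact hm h0 (Set.mem_Iic.2 le_rfl) h0
  simp only [hF] at key
  simp at key
  linarith

/-- The homogeneous form of `one_sub_rpow_le`, with `d = 1 - b / a`. -/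
theorem rpow_sub_rpow_le {p a b : ℝ} (hp : 2 ≤ p) (ha : 0 ≤ a) (hb : 0 ≤ b) :
    a ^ p - b ^ p ≤ p * (a - b) * (((p - 1) * a + b) / p) ^ (p - 1) := by
  have hp0 : 0 < p := by linarith
  rcases ha.eq_or_lt with rfl | ha
  · rw [Real.zero_rpow hp0.ne']
    have h1 : (b / p) ^ (p - 1) ≤ b ^ (p - 1) / p := by
      rw [Real.div_rpow hb hp0.le]
      refine div_le_div_of_nonneg_left (by positivity) hp0 ?_
      calc p = p ^ (1 : ℝ) := (Real.rpow_one p).symm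
        _ ≤ p ^ (p - 1) := Real.rpow_le_rpow_of_exponent_le (by linarith) (by linarith)
    have h2 : b ^ p = b * b ^ (p - 1) := by
      rw [rpow_eq_mul_sq hp hb, rpow_sub_one_eq_mul hp hb]; ring
    have h3 : p * b * (b / p) ^ (p - 1) ≤ p * b * (b ^ (p - 1) / p) := by gcongr
    rw [h2]
    have h4 : p * b * (b ^ (p - 1) / p) = b * b ^ (p - 1) := by field_simp
    simp only [mul_zero, zero_add, zero_sub]
    linarith
  · have h := one_sub_rpow_le hp (d := 1 - b / a) (by linarith [div_nonneg hb ha.le])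
    have e1 : 1 - (1 - b / a) / p = (((p - 1) * a + b) / p) / a := by field_simp; ring
    have hc : 0 ≤ ((p - 1) * a + b) / p := by
      have : 0 ≤ (p - 1) * a := mul_nonneg (by linarith) ha.le
      positivity
    rw [sub_sub_cancel, e1, Real.div_rpow hb ha.le, Real.div_rpow hc ha.le] at h
    have h2 : a ^ p = a * a ^ (p - 1) := by
      rw [rpow_eq_mul_sq hp ha.le, rpow_sub_one_eq_mul hp ha.le]; ring
    have := mul_le_mul_of_nonneg_right h (by positivity : 0 ≤ a ^ p)
    refine (le_of_eq ?_).trans (this.trans (le_of_eq ?_))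
    · field_simp
    · rw [h2]; field_simp

/-- Burkholder's majorisation: with the optimal constant, his function dominates a multiple of
`s ^ p - (p - 1) ^ p * r ^ p`. -/
theorem rpow_sub_le_burkholder {p r s : ℝ} (hp : 2 ≤ p) (hr : 0 ≤ r) (hs : 0 ≤ s) :
    (s ^ p / (p - 1) ^ (p - 1) - (p - 1) * r ^ p) / p ≤ p ^ (1 - p) * burkholder p r s := by
  have hp0 : 0 < p := by linarith
  have hp1 : 0 < p - 1 := by linarith
  have h := rpow_sub_rpow_le hp hs (mul_nonneg hp1.le hr)
  have e : ((p - 1) * s + (p - 1) * r) / p = (p - 1) * (r + s) / p := by ring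
  rw [e, Real.div_rpow (by positivity) hp0.le, Real.mul_rpow hp1.le hr,
    Real.mul_rpow hp1.le (by positivity)] at h
  have e2 : (p - 1) ^ p = (p - 1) * (p - 1) ^ (p - 1) := by
    rw [mul_comm, ← Real.rpow_add_one hp1.ne']; congr 1; ring
  have e3 : p ^ (1 - p) = (p ^ (p - 1))⁻¹ := by
    rw [← Real.rpow_neg hp0.le]; congr 1; ring
  rw [e2] at h
  rw [e3, burkholder]
  have hA : 0 < (p - 1) ^ (p - 1) := by positivity
  have hB : 0 < p ^ (p - 1) := by positivity
  generalize (p - 1) ^ (p - 1) = A at *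
  generalize p ^ (p - 1) = B at *
  have h' := div_le_div_of_nonneg_right h (by positivity : 0 ≤ p * A)
  refine (le_of_eq ?_).trans (h'.trans (le_of_eq ?_))
  · field_simp
  · field_simp

/-- Zigzag concavity of Burkholder's function: for increments `h`, `k` of equal length it lies below
its tangent plane, globally. The number `β` stands for `(p - 2) ‖x‖ / ‖z‖`; stating this without a
division also covers `z = 0` when `(p - 2) ‖x‖ = 0`. -/
theorem burkholder_zigzag {E : Type*} [NormedAddCommGroup E] [InnerProductSpace ℝ E]
    {p β : ℝ} (hp : 2 ≤ p) (x z h k : E) (hhk : ‖k‖ = ‖h‖) (hβ : 0 ≤ β)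
    (hβz : β * ‖z‖ = (p - 2) * ‖x‖) :
    burkholder p ‖x + h‖ ‖z + k‖ ≤ burkholder p ‖x‖ ‖z‖ + p * (‖x‖ + ‖z‖) ^ (p - 2) *
      (-(p - 1) * inner ℝ x h + (1 - β) * inner ℝ z k) := by
  have hx := norm_add_sq_real x h
  have hz := norm_add_sq_real z k
  have h1 : |‖z + k‖ - ‖z‖| ≤ ‖k‖ := by
    simpa using abs_norm_sub_norm_le (z + k) z
  have h2 : ‖h‖ ≤ ‖x + h‖ + ‖x‖ := by
    simpa using norm_sub_le (x + h) x
  rw [hhk] at hz h1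
  have h3 : ‖z + k‖ - ‖z‖ ≤ ‖x + h‖ + ‖x‖ := (le_abs_self _).trans (h1.trans h2)
  have h4 : (‖z + k‖ - ‖z‖) ^ 2 ≤ ‖h‖ ^ 2 := by
    rw [← sq_abs]; gcongr
  have hr := norm_nonneg x
  have hs := norm_nonneg z
  have hr1 := norm_nonneg (x + h)
  have hs1 := norm_nonneg (z + k)
  generalize ‖x + h‖ = r₁ at *
  generalize ‖z + k‖ = s₁ at *
  generalize ‖x‖ = r at *
  generalize ‖z‖ = s at *
  generalize inner ℝ x h = a at *
  generalize inner ℝ z k = b at *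
  generalize ‖h‖ ^ 2 = m at *
  clear h1 h2 hhk
  obtain rfl : a = (r₁ ^ 2 - r ^ 2 - m) / 2 := by linarith
  obtain rfl : b = (s₁ ^ 2 - s ^ 2 - m) / 2 := by linarith
  clear hx hz
  unfold burkholder
  have hu : 0 ≤ r + s := by positivity
  have hv : 0 ≤ r₁ + s₁ := by positivity
  have t1 := rpow_tangent_le hp hu hv
  have t2 := rpow_le_taylor_two hp hv (u := r + s)
  have t3 := rpow_sub_rpow_le_trapezoid hp hu (v := r₁ + s₁)
  have e1 := rpow_sub_one_eq_mul hp hu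
  have e2 : (r + s) ^ p = (r + s) ^ (p - 1) * (r + s) := by
    rw [rpow_eq_mul_sq hp hu, e1]; ring
  have e3 : (r₁ + s₁) ^ p = (r₁ + s₁) ^ (p - 1) * (r₁ + s₁) := by
    rw [rpow_eq_mul_sq hp hv, rpow_sub_one_eq_mul hp hv]; ring
  have hK : 0 ≤ (r + s) ^ (p - 2) := by positivity
  rw [e2, e3, e1] at t2 t3
  rw [e1] at t1 ⊢
  generalize (r + s) ^ (p - 2) = K at *
  generalize (r₁ + s₁) ^ (p - 1) = V at *
  clear e1 e2 e3
  -- The right-hand side increases with `m ≥ (s₁ - s) ^ 2`. After insertion of this least value of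
  -- `m`, both sides are affine in `r₁` for fixed `v = r₁ + s₁`, and by `t1` their difference
  -- increases with `r₁`. It remains to treat the least `r₁`.
  have hm : p * K * (-(p - 1) * ((r₁ ^ 2 - r ^ 2 - (s₁ - s) ^ 2) / 2)
      + (s - (p - 2) * r) * (s₁ - s)) ≤
      p * K * (-(p - 1) * ((r₁ ^ 2 - r ^ 2 - m) / 2) + (1 - β) * ((s₁ ^ 2 - s ^ 2 - m) / 2)) := by
    refine mul_le_mul_of_nonneg_left ?_ (by positivity)
    have : 0 ≤ (p - 2 + β) * (m - (s₁ - s) ^ 2) :=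
      mul_nonneg (by linarith) (by linarith)
    rw [← hβz]
    nlinarith
  refine le_trans ?_ (add_le_add_right hm _)
  obtain ⟨v, rfl⟩ : ∃ v, s₁ = v - r₁ := ⟨r₁ + s₁, by ring⟩
  rw [add_sub_cancel] at *
  rcases le_total v (r + s) with hvu | hvu
  -- Here `r₁ ≥ 0`, and `r₁ = 0` is the Taylor estimate.
  · have t2 := t2 hvu
    have := mul_nonneg (mul_nonneg (by linarith : 0 ≤ p) hr1) (sub_nonneg.2 t1)
    linear_combination t2 + this
  -- Here `h3` gives `r₁ ≥ (v - (r + s)) / 2`, and equality is the trapezoidal rule.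
  · have t3 := t3 hvu
    have := mul_nonneg (mul_nonneg (by linarith : 0 ≤ p) (by linarith : 0 ≤ r₁ - (v - (r + s)) / 2))
      (sub_nonneg.2 t1)
    linear_combination t3 + this

/-! ### The Bellman function -/

theorem hasDerivAt_burkholder {p : ℝ} (hp : 2 ≤ p) {r s : ℝ} (hr : 0 ≤ r) (hs : 0 ≤ s) :
    HasDerivAt (burkholder p r) (p * (r + s) ^ (p - 2) * (s - (p - 2) * r)) s := by
  have h1 := (hasDerivAt_id s).sub_const ((p - 1) * r)
  have h2 := ((hasDerivAt_id s).const_add r).rpow_const (p := p - 1) (Or.inr (by linarith))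
  refine (h1.mul h2).congr_deriv ?_
  simp only [id]
  rw [show p - 1 - 1 = p - 2 by ring, rpow_sub_one_eq_mul hp (by positivity)]
  ring

theorem continuous_burkholder {p : ℝ} (hp : 2 ≤ p) (r : ℝ) : Continuous (burkholder p r) := by
  unfold burkholder
  have : Continuous fun s : ℝ => (r + s) ^ (p - 1) :=
    (continuous_const.add continuous_id).rpow_const fun _ => Or.inr (by linarith)
  fun_prop

/-- The Legendre transform of Burkholder's function in its second argument is attained. -/
theorem exists_burkholder_maximizer {p r y : ℝ} (hp : 2 ≤ p) (hr : 0 ≤ r) (hy : 0 ≤ y) :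
    ∃ s, 0 ≤ s ∧ ∀ s', 0 ≤ s' → s' * y - p ^ (1 - p) * burkholder p r s' ≤
      s * y - p ^ (1 - p) * burkholder p r s := by
  have hκ : 0 < p ^ (1 - p) := Real.rpow_pos_of_pos (by linarith) _
  set κ := p ^ (1 - p)
  set R := 2 * (p - 1) * r + 1 + 2 * y / κ with hR
  have hpr : 0 ≤ (p - 1) * r := mul_nonneg (by linarith) hr
  have hyκ : 0 ≤ 2 * y / κ := by positivity
  have hR0 : 0 ≤ R := by linarith
  have hcont : ContinuousOn (fun s => s * y - κ * burkholder p r s) (Set.Icc 0 R) := by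
    have := continuous_burkholder hp r
    fun_prop
  obtain ⟨s, hs, hmax⟩ := isCompact_Icc.exists_isMaxOn ⟨0, le_rfl, hR0⟩ hcont
  refine ⟨s, hs.1, fun s' hs' => ?_⟩
  rcases le_total s' R with h | h
  · exact hmax ⟨hs', h⟩
  -- Beyond `R` the function is nonpositive, while it is nonnegative at `0`.
  · have h0 : (0 : ℝ) ≤ 0 * y - κ * burkholder p r 0 := by
      have : 0 ≤ κ * ((p - 1) * r * (r + 0) ^ (p - 1)) := by positivity
      unfold burkholder
      linarith
    refine le_trans ?_ (h0.trans (hmax ⟨le_rfl, hR0⟩))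
    have h1 : s' ≤ (r + s') ^ (p - 1) := by
      calc s' ≤ r + s' := by linarith
        _ = (r + s') ^ (1 : ℝ) := (Real.rpow_one _).symm
        _ ≤ (r + s') ^ (p - 1) :=
          Real.rpow_le_rpow_of_exponent_le (by linarith) (by linarith)
    have h2 : s' / 2 * s' ≤ burkholder p r s' :=
      mul_le_mul (by linarith) h1 hs' (by linarith)
    have h3 : y ≤ κ * (s' / 2) := by
      have : 2 * y / κ ≤ s' := by linarith
      rw [div_le_iff₀ hκ] at this
      linarith
    nlinarith [mul_le_mul_of_nonneg_left h2 hκ.le, mul_le_mul_of_nonneg_left h3 hs']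

/-- The first-order condition at a maximiser. The number `β` stands for `(p - 2) r / s`, and also
covers the maximiser `s = 0`, which occurs only if `(p - 2) r = 0`. -/
theorem burkholder_maximizer_spec {p r y s : ℝ} (hp : 2 ≤ p) (hr : 0 ≤ r) (hy : 0 ≤ y)
    (hs : 0 ≤ s) (hmax : ∀ s', 0 ≤ s' → s' * y - p ^ (1 - p) * burkholder p r s' ≤
      s * y - p ^ (1 - p) * burkholder p r s) :
    ∃ β, 0 ≤ β ∧ β * s = (p - 2) * r ∧
      y = p ^ (1 - p) * (p * (r + s) ^ (p - 2) * ((1 - β) * s)) := by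
  have hκ : 0 < p ^ (1 - p) := Real.rpow_pos_of_pos (by linarith) _
  set κ := p ^ (1 - p)
  have hd : HasDerivAt (fun s => s * y - κ * burkholder p r s)
      (y - κ * (p * (r + s) ^ (p - 2) * (s - (p - 2) * r))) s :=
    (((hasDerivAt_id s).mul_const y).sub
      ((hasDerivAt_burkholder hp hr hs).const_mul κ)).congr_deriv (by simp)
  rcases hs.eq_or_lt with rfl | hs
  · have hle : y - κ * (p * (r + 0) ^ (p - 2) * (0 - (p - 2) * r)) ≤ 0 := by
      by_contra! hpos
      have h1 := hd.tendsto_slope.mono_left (nhdsGT_le_nhdsNE (0 : ℝ))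
      obtain ⟨t, ht, ht0⟩ := ((h1.eventually (lt_mem_nhds hpos)).and self_mem_nhdsWithin).exists
      have ht0 : 0 < t := ht0
      rw [slope_def_field, lt_div_iff₀ (by linarith)] at ht
      have := hmax t ht0.le
      linarith
    have h2 : 0 ≤ κ * (p * (r + 0) ^ (p - 2) * ((p - 2) * r)) := by
      have : 0 ≤ p - 2 := by linarith
      positivity
    have hy0 : y = 0 := by linarith
    refine ⟨0, le_rfl, ?_, by simpa using hy0⟩
    have h3 : κ * (p * (r + 0) ^ (p - 2) * ((p - 2) * r)) = 0 := by linarith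
    rcases hr.eq_or_lt with rfl | hr
    · simp
    · have : 0 < κ * (p * (r + 0) ^ (p - 2)) := by
        have : 0 < p := by linarith
        positivity
      rw [← mul_assoc] at h3
      rw [(mul_eq_zero.1 h3).resolve_left this.ne', zero_mul]
  · refine ⟨(p - 2) * r / s, div_nonneg (mul_nonneg (by linarith) hr) hs.le, by field_simp, ?_⟩
    have hloc : IsLocalMax (fun s => s * y - κ * burkholder p r s) s := by
      filter_upwards [lt_mem_nhds hs] with t ht using hmax t (le_of_lt ht)
    have h0 := hloc.hasDerivAt_eq_zero hd
    rw [show (1 - (p - 2) * r / s) * s = s - (p - 2) * r by field_simp]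
    linarith

theorem exists_unit_vector (y : ℂ) : ∃ ω : ℂ, ‖ω‖ = 1 ∧ y = ‖y‖ • ω := by
  rcases eq_or_ne y 0 with rfl | hy
  · exact ⟨1, by simp⟩
  · have := norm_ne_zero_iff.2 hy
    exact ⟨‖y‖⁻¹ • y, by simp [this], by simp [this]⟩

/-- A nonnegative function on `ℂ × ℂ` that is convex with gain: at every point it has a
supporting affine function which it exceeds by at least the product of the moduli of the two
increments. -/
def IsConvexWithGain (Φ : ℂ → ℂ → ℝ) : Prop :=
  (∀ x y, 0 ≤ Φ x y) ∧ ∀ x y, ∃ A B : ℂ →ₗ[ℝ] ℝ, ∀ x' y',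
    Φ x y + A (x' - x) + B (y' - y) + ‖x' - x‖ * ‖y' - y‖ ≤ Φ x' y'

/-- The upper bound for the Legendre transform: the majorisation, followed by Young's inequality for
`s * y` with the weights that make both constants equal to `p - 1`. -/
theorem burkholder_young {p q : ℝ} (hpq : p.HolderConjugate q) (hp : 2 ≤ p) {r s y : ℝ}
    (hr : 0 ≤ r) (hs : 0 ≤ s) (hy : 0 ≤ y) :
    s * y - p ^ (1 - p) * burkholder p r s ≤ (p - 1) * (r ^ p / p + y ^ q / q) := by
  have hp1 : 0 < p - 1 := by linarith
  have hq0 : 0 < q := hpq.symm.pos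
  have hmaj := rpow_sub_le_burkholder hp hr hs
  set l := (p - 1) ^ (1 / q) with hl
  have hl0 : 0 < l := by positivity
  have hlq : l ^ q = p - 1 := by
    rw [hl, ← Real.rpow_mul hp1.le, one_div_mul_cancel hq0.ne', Real.rpow_one]
  have hlp : l ^ p = (p - 1) ^ (p - 1) := by
    rw [hl, ← Real.rpow_mul hp1.le]
    congr 1
    rw [one_div, ← div_eq_inv_mul, div_eq_iff hq0.ne']
    linarith [hpq.mul_eq_add]
  have hY := Real.young_inequality_of_nonneg (div_nonneg hs hl0.le) (mul_nonneg hl0.le hy) hpq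
  rw [Real.div_rpow hs hl0.le, Real.mul_rpow hl0.le hy, hlq, hlp] at hY
  have e1 : s / l * (l * y) = s * y := by field_simp
  rw [e1] at hY
  rw [sub_div] at hmaj
  linear_combination hmaj + hY

/-- The Bellman function: `Φ(x, y)` is the maximum over `s ≥ 0` of
`s |y| - p ^ (1 - p) * burkholder p |x| s`. -/
theorem exists_bellman {p q : ℝ} (hpq : p.HolderConjugate q) (hp : 2 ≤ p) :
    ∃ Φ : ℂ → ℂ → ℝ, IsConvexWithGain Φ ∧
      ∀ x y, Φ x y ≤ (p - 1) * (‖x‖ ^ p / p + ‖y‖ ^ q / q) := by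
  have hκ : 0 < p ^ (1 - p) := Real.rpow_pos_of_pos (by linarith) _
  choose! S hS0 hSmax using fun (x y : ℂ) =>
    exists_burkholder_maximizer hp (norm_nonneg x) (norm_nonneg y)
  refine ⟨fun x y => S x y * ‖y‖ - p ^ (1 - p) * burkholder p ‖x‖ (S x y), ⟨?_, ?_⟩, ?_⟩
  · intro x y
    refine le_trans ?_ (hSmax x y 0 le_rfl)
    have : 0 ≤ p ^ (1 - p) * ((p - 1) * ‖x‖ * (‖x‖ + 0) ^ (p - 1)) := by
      have : 0 ≤ p - 1 := by linarith
      positivity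
    unfold burkholder
    linarith
  · intro x y
    have hs := hS0 x y
    obtain ⟨β, hβ, hβs, hy⟩ := burkholder_maximizer_spec hp (norm_nonneg x) (norm_nonneg y) hs
      (hSmax x y)
    dsimp only
    generalize S x y = s at *
    obtain ⟨ω, hω, hyω⟩ := exists_unit_vector y
    set z := s • ω with hz
    have hzn : ‖z‖ = s := by rw [hz, norm_smul, hω, mul_one, Real.norm_of_nonneg hs]
    refine ⟨(p ^ (1 - p) * (p * (‖x‖ + s) ^ (p - 2) * (p - 1))) • (innerₛₗ ℝ x), innerₛₗ ℝ z,
      fun x' y' => ?_⟩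
    -- The competitor `z + k` for `(x', y')`, where `k` has the length of `x' - x` and the
    -- direction of `y' - y`
    obtain ⟨ν, hν, hyν⟩ := exists_unit_vector (y' - y)
    set k := ‖x' - x‖ • ν with hk
    have hkn : ‖k‖ = ‖x' - x‖ := by rw [hk, norm_smul, hν, mul_one, norm_norm]
    have hkin : inner ℝ k (y' - y) = ‖x' - x‖ * ‖y' - y‖ := by
      conv_lhs => rw [hk, hyν, real_inner_smul_left, real_inner_smul_right,
        real_inner_self_eq_norm_sq, hν]
      ring
    clear_value z k
    have hzz := burkholder_zigzag hp x z (x' - x) k hkn hβ (by rw [hzn, hβs])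
    have hcs : inner ℝ (z + k) y' ≤ ‖z + k‖ * ‖y'‖ := real_inner_le_norm _ _
    have hzy : inner ℝ z y = s * ‖y‖ := by
      conv_lhs => rw [hz, hyω, real_inner_smul_left, real_inner_smul_right,
        real_inner_self_eq_norm_sq, hω]
      ring
    have hyk : inner ℝ k y =
        p ^ (1 - p) * (p * (‖x‖ + s) ^ (p - 2) * ((1 - β) * inner ℝ z k)) := by
      rw [hz, real_inner_smul_left, real_inner_comm k ω]
      conv_lhs => rw [hyω, real_inner_smul_right, hy]
      ring
    have hsplit : inner ℝ (z + k) y' =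
        inner ℝ z y + inner ℝ z (y' - y) + inner ℝ k y + inner ℝ k (y' - y) := by
      simp only [inner_add_left, inner_sub_right]
      ring
    have hmax := hSmax x' y' ‖z + k‖ (norm_nonneg _)
    rw [add_sub_cancel, hzn] at hzz
    have hzz := mul_le_mul_of_nonneg_left hzz hκ.le
    simp only [LinearMap.smul_apply, innerₛₗ_apply_apply, smul_eq_mul]
    refine le_trans ?_ hmax
    rw [hsplit, hzy, hyk, hkin] at hcs
    linear_combination hcs + hzz
  · intro x y
    exact burkholder_young hpq hp (norm_nonneg x) (hS0 x y) (norm_nonneg y)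

/-- The gain is bilinear in the increments, so it is preserved by this two-parameter rescaling, which
allows the two functions to be normalised separately. -/
theorem IsConvexWithGain.rescale {Φ : ℂ → ℂ → ℝ} (hΦ : IsConvexWithGain Φ) {a b : ℝ}
    (ha : 0 < a) (hb : 0 < b) :
    IsConvexWithGain fun x y => a * b * Φ (a⁻¹ • x) (b⁻¹ • y) := by
  refine ⟨fun x y => mul_nonneg (by positivity) (hΦ.1 _ _), fun x y => ?_⟩
  obtain ⟨A, B, h⟩ := hΦ.2 (a⁻¹ • x) (b⁻¹ • y)
  refine ⟨b • A, a • B, fun x' y' => ?_⟩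
  have := mul_le_mul_of_nonneg_left (h (a⁻¹ • x') (b⁻¹ • y')) (by positivity : 0 ≤ a * b)
  simp only [← smul_sub, map_smul, norm_smul, norm_inv, Real.norm_of_nonneg ha.le,
    Real.norm_of_nonneg hb.le, smul_eq_mul, LinearMap.smul_apply] at this ⊢
  refine le_trans (le_of_eq ?_) this
  field_simp

/-! ### The Euler scheme for the heat equation -/

section Discretisation

variable {G : Type*} [AddCommGroup G] {N : ℕ}

/-- The discrete Laplacian as an endomorphism of the space of all functions. -/
def laplacianEnd (e : G) : Module.End ℂ ((Fin N → G) → ℂ) where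
  toFun := discreteLaplacian e
  map_add' f g := by
    ext n
    simp only [discreteLaplacian, rightDeriv, leftDeriv, Pi.add_apply, ← Finset.sum_add_distrib]
    exact Finset.sum_congr rfl fun i _ => by ring
  map_smul' c f := by
    ext n
    simp only [discreteLaplacian, rightDeriv, leftDeriv, Pi.smul_apply, smul_eq_mul,
      RingHom.id_apply, Finset.mul_sum]
    exact Finset.sum_congr rfl fun i _ => by ring

/-- One explicit Euler step of length `ε` for the heat equation. -/
noncomputable def heatStep (e : G) (ε : ℝ) (f : (Fin N → G) → ℂ) : (Fin N → G) → ℂ :=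
  fun n => f n + ε * discreteLaplacian e f n

theorem discreteLaplacian_apply (e : G) (f : (Fin N → G) → ℂ) (n : Fin N → G) :
    discreteLaplacian e f n =
      ∑ i, ((f (n + Pi.single i e) - f n) + (f (n - Pi.single i e) - f n)) := by
  refine Finset.sum_congr rfl fun i _ => ?_
  simp only [rightDeriv, leftDeriv, add_sub_cancel_right]
  ring

/-- The binomial expansion of `(1 + ε Δ) ^ K`, written as an infinite series to match the exponential
series. -/
theorem heatStep_iterate_apply (e : G) (ε : ℝ) (f : (Fin N → G) → ℂ) (K : ℕ) (n : Fin N → G) :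
    (heatStep e ε)^[K] f n =
      ∑' k, (((K.choose k : ℝ) * ε ^ k : ℝ) : ℂ) * (discreteLaplacian e)^[k] f n := by
  have h1 : heatStep e ε = ⇑((ε : ℂ) • laplacianEnd (N := N) e + 1) := by
    ext f n
    exact add_comm _ _
  rw [h1, ← Module.End.coe_pow, (Commute.one_right _).add_pow,
    tsum_eq_sum (s := Finset.range (K + 1)) fun k hk => by
      rw [Finset.mem_range, not_lt] at hk
      rw [Nat.choose_eq_zero_of_lt (by omega)]
      simp]
  simp only [one_pow, mul_one, smul_pow, LinearMap.sum_apply, Finset.sum_apply]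
  refine Finset.sum_congr rfl fun k _ => ?_
  rw [(Nat.cast_commute (K.choose k) _).symm.eq, ← nsmul_eq_mul, LinearMap.smul_apply,
    LinearMap.smul_apply, Module.End.coe_pow]
  simp [laplacianEnd, mul_assoc]

theorem tendsto_choose_floor_mul_pow {t : ℝ} (ht : 0 < t) (k : ℕ) :
    Tendsto (fun m : ℕ => ((⌊t * m⌋₊.choose k : ℝ)) * (1 / (m : ℝ)) ^ k) atTop
      (𝓝 (t ^ k / k !)) := by
  have hK := tendsto_nat_floor_mul_atTop t ht
  have h1 := (tendsto_nat_floor_mul_div_atTop (R := ℝ) ht.le).comp tendsto_natCast_atTop_atTop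
  have h2 := (isEquivalent_choose k).comp_tendsto hK
  have h3 := h2.mul (Asymptotics.IsEquivalent.refl (u := fun m : ℕ => (1 / (m : ℝ)) ^ k))
  refine h3.symm.tendsto_nhds ?_
  refine ((h1.pow k).div_const (k ! : ℝ)).congr fun m => ?_
  simp only [Function.comp_apply, Pi.mul_apply, div_pow, one_pow]
  ring

/-- The Euler scheme with step `1 / m` converges pointwise to the heat extension. -/
theorem tendsto_heatStep_iterate (e : G) {f : (Fin N → G) → ℂ} {C : ℝ} (hf : ∀ n, ‖f n‖ ≤ C)
    {t : ℝ} (ht : 0 < t) (n : Fin N → G) :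
    Tendsto (fun m : ℕ => (heatStep e (1 / m))^[⌊t * m⌋₊] f n) atTop
      (𝓝 (heatExtension e f n t)) := by
  simp only [heatStep_iterate_apply, heatExtension]
  refine tendsto_tsum_of_dominated_convergence (summable_heatExtension e f C hf n t)
    (fun k => ?_) (Eventually.of_forall fun m k => ?_)
  · have := (Complex.continuous_ofReal.tendsto _).comp (tendsto_choose_floor_mul_pow ht k)
    simpa using this.mul_const _
  · rw [norm_mul, norm_mul]
    refine mul_le_mul_of_nonneg_right ?_ (norm_nonneg _)
    rw [Complex.norm_real, norm_div, norm_pow, Complex.norm_real, Complex.norm_natCast,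
      Real.norm_of_nonneg (by positivity), Real.norm_of_nonneg ht.le]
    rcases m.eq_zero_or_pos with rfl | hm
    · rcases k.eq_zero_or_pos with rfl | hk
      · simp
      · simp [hk.ne']
        positivity
    · have hm' : (0 : ℝ) < m := by exact_mod_cast hm
      calc (⌊t * m⌋₊.choose k : ℝ) * (1 / (m : ℝ)) ^ k
          ≤ ((⌊t * m⌋₊ : ℝ) ^ k / k !) * (1 / (m : ℝ)) ^ k := by
            gcongr
            exact Nat.choose_le_pow_div k _
        _ ≤ ((t * m) ^ k / k !) * (1 / (m : ℝ)) ^ k := by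
            gcongr
            exact Nat.floor_le (by positivity)
        _ = t ^ k / k ! := by
            rw [div_mul_eq_mul_div, ← mul_pow, mul_one_div, mul_div_cancel_right₀ _ hm'.ne']

theorem tendsto_heatStep_iterate_succ (e : G) {f : (Fin N → G) → ℂ} {C : ℝ}
    (hf : ∀ n, ‖f n‖ ≤ C) {t : ℝ} (ht : 0 < t) (n : Fin N → G) :
    Tendsto (fun m : ℕ => heatStep e (1 / m) ((heatStep e (1 / m))^[⌊t * m⌋₊] f) n) atTop
      (𝓝 (heatExtension e f n t)) := by
  have h0 := tendsto_heatStep_iterate e hf ht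
  have h1 : Tendsto (fun m : ℕ =>
      discreteLaplacian e ((heatStep e (1 / m))^[⌊t * m⌋₊] f) n) atTop
      (𝓝 (discreteLaplacian e (fun n => heatExtension e f n t) n)) := by
    simp only [discreteLaplacian_apply]
    exact tendsto_finsetSum _ fun i _ => ((h0 _).sub (h0 _)).add ((h0 _).sub (h0 _))
  have h2 : Tendsto (fun m : ℕ => ((1 / (m : ℝ) : ℝ) : ℂ)) atTop (𝓝 0) := by
    rw [← Complex.ofReal_zero]
    exact (Complex.continuous_ofReal.tendsto 0).comp tendsto_one_div_atTop_nhds_zero_nat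
  simpa [heatStep] using (h0 n).add (h2.mul h1)

/-! ### Decrease of the Bellman sum along the scheme -/

/-- The lower bound for the gain of a convex function over one Euler step of length `ε` at the site
`n`, per unit of time: the increments are measured from the updated value at `n`. -/
noncomputable def stepGain (e : G) (ε : ℝ) (f g : (Fin N → G) → ℂ) (n : Fin N → G) : ℝ :=
  ∑ i, (‖f (n + Pi.single i e) - heatStep e ε f n‖ * ‖g (n + Pi.single i e) - heatStep e ε g n‖ +
    ‖f (n - Pi.single i e) - heatStep e ε f n‖ * ‖g (n - Pi.single i e) - heatStep e ε g n‖)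

theorem stepGain_nonneg (e : G) (ε : ℝ) (f g : (Fin N → G) → ℂ) (n : Fin N → G) :
    0 ≤ stepGain e ε f g n := by
  unfold stepGain
  positivity

/-- For `2 N ε ≤ 1`, an Euler step replaces the value at `n` by a convex combination of the values
at `n` and at its neighbours, so Jensen's inequality applies. -/
theorem IsConvexWithGain.heatStep_le {Φ : ℂ → ℂ → ℝ} (hΦ : IsConvexWithGain Φ) (e : G)
    {ε : ℝ} (hε : 0 ≤ ε) (hNε : 2 * N * ε ≤ 1) (f g : (Fin N → G) → ℂ) (n : Fin N → G) :
    Φ (heatStep e ε f n) (heatStep e ε g n) + ε * stepGain e ε f g n ≤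
      (1 - 2 * N * ε) * Φ (f n) (g n) + ε * ∑ i : Fin N,
        (Φ (f (n + Pi.single i e)) (g (n + Pi.single i e)) +
          Φ (f (n - Pi.single i e)) (g (n - Pi.single i e))) := by
  obtain ⟨A, B, h⟩ := hΦ.2 (heatStep e ε f n) (heatStep e ε g n)
  have h0 : Φ (heatStep e ε f n) (heatStep e ε g n) + A (f n - heatStep e ε f n)
      + B (g n - heatStep e ε g n) ≤ Φ (f n) (g n) :=
    le_trans (le_add_of_nonneg_right (by positivity)) (h (f n) (g n))
  have hs := Finset.sum_le_sum fun (i : Fin N) (_ : i ∈ Finset.univ) =>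
    add_le_add (h (f (n + Pi.single i e)) (g (n + Pi.single i e)))
      (h (f (n - Pi.single i e)) (g (n - Pi.single i e)))
  -- The affine parts of the supporting functions cancel in the average
  have hlin : ∀ (L : ℂ →ₗ[ℝ] ℝ) (u : (Fin N → G) → ℂ),
      (1 - 2 * N * ε) * L (u n - heatStep e ε u n) + ε * ∑ i : Fin N,
        (L (u (n + Pi.single i e) - heatStep e ε u n) +
          L (u (n - Pi.single i e) - heatStep e ε u n)) = 0 := by
    intro L u
    have e1 : heatStep e ε u n = u n + ε • discreteLaplacian e u n := by
      simp [heatStep]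
    have e2 : L (discreteLaplacian e u n) = ∑ i,
        ((L (u (n + Pi.single i e)) - L (u n)) + (L (u (n - Pi.single i e)) - L (u n))) := by
      simp only [discreteLaplacian_apply, map_sum, map_add, map_sub]
    rw [e1]
    simp only [map_sub, map_add, map_smul, e2, smul_eq_mul, Finset.sum_add_distrib,
      Finset.sum_sub_distrib, Finset.sum_const, Finset.card_univ, Fintype.card_fin, nsmul_eq_mul]
    ring
  have hA := hlin A f
  have hB := hlin B g
  have h0' := mul_le_mul_of_nonneg_left h0 (sub_nonneg.2 hNε)
  have hs' := mul_le_mul_of_nonneg_left hs hε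
  unfold stepGain
  simp only [Finset.sum_add_distrib, Finset.sum_const, Finset.card_univ, Fintype.card_fin,
    nsmul_eq_mul] at hA hB hs' ⊢
  linear_combination h0' + hs' - hA - hB

/-- Summed over the group, the neighbour terms are translates of one another and the weights add up
to `1`. -/
theorem IsConvexWithGain.tsum_heatStep_le {Φ : ℂ → ℂ → ℝ} (hΦ : IsConvexWithGain Φ) (e : G)
    {ε : ℝ} (hε : 0 ≤ ε) (hNε : 2 * N * ε ≤ 1) (f g : (Fin N → G) → ℂ) :
    ∑' n, ENNReal.ofReal (Φ (heatStep e ε f n) (heatStep e ε g n)) +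
        ENNReal.ofReal ε * ∑' n, ENNReal.ofReal (stepGain e ε f g n) ≤
      ∑' n, ENNReal.ofReal (Φ (f n) (g n)) := by
  set S := ∑' n, ENNReal.ofReal (Φ (f n) (g n)) with hS
  have hp : ∀ i : Fin N, ∑' n : Fin N → G, ENNReal.ofReal (Φ (f (n + Pi.single i e)) (g (n + Pi.single i e)))
      = S := fun i => (Equiv.addRight (Pi.single i e : Fin N → G)).tsum_eq
        fun n => ENNReal.ofReal (Φ (f n) (g n))
  have hm : ∀ i : Fin N, ∑' n : Fin N → G, ENNReal.ofReal (Φ (f (n - Pi.single i e)) (g (n - Pi.single i e)))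
      = S := fun i => (Equiv.subRight (Pi.single i e : Fin N → G)).tsum_eq
        fun n => ENNReal.ofReal (Φ (f n) (g n))
  have h1 : 0 ≤ 1 - 2 * N * ε := sub_nonneg.2 hNε
  calc _ = ∑' n, ENNReal.ofReal
        (Φ (heatStep e ε f n) (heatStep e ε g n) + ε * stepGain e ε f g n) := by
        rw [← ENNReal.tsum_mul_left, ← ENNReal.tsum_add]
        refine tsum_congr fun n => ?_
        rw [ENNReal.ofReal_add (hΦ.1 _ _) (mul_nonneg hε (stepGain_nonneg ..)),
          ENNReal.ofReal_mul hε]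
    _ ≤ ∑' n, (ENNReal.ofReal (1 - 2 * N * ε) * ENNReal.ofReal (Φ (f n) (g n)) +
        ENNReal.ofReal ε * ∑ i : Fin N,
          (ENNReal.ofReal (Φ (f (n + Pi.single i e)) (g (n + Pi.single i e))) +
            ENNReal.ofReal (Φ (f (n - Pi.single i e)) (g (n - Pi.single i e))))) := by
        refine ENNReal.tsum_le_tsum fun n => ?_
        refine (ENNReal.ofReal_le_ofReal (hΦ.heatStep_le e hε hNε f g n)).trans (le_of_eq ?_)
        have hnn : ∀ i : Fin N, 0 ≤ Φ (f (n + Pi.single i e)) (g (n + Pi.single i e)) +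
          Φ (f (n - Pi.single i e)) (g (n - Pi.single i e)) :=
          fun i => add_nonneg (hΦ.1 _ _) (hΦ.1 _ _)
        rw [ENNReal.ofReal_add (mul_nonneg h1 (hΦ.1 _ _))
          (mul_nonneg hε (Finset.sum_nonneg fun i _ => hnn i)), ENNReal.ofReal_mul h1,
          ENNReal.ofReal_mul hε, ENNReal.ofReal_sum_of_nonneg fun i _ => hnn i]
        simp only [ENNReal.ofReal_add (hΦ.1 _ _) (hΦ.1 _ _)]
    _ = ENNReal.ofReal (1 - 2 * N * ε) * S + ENNReal.ofReal ε * ∑ i : Fin N, (S + S) := by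
        rw [ENNReal.tsum_add, ENNReal.tsum_mul_left, ENNReal.tsum_mul_left,
          Summable.tsum_finsetSum fun _ _ => ENNReal.summable]
        simp only [ENNReal.tsum_add, hp, hm, hS]
    _ = S := by
        have : ENNReal.ofReal ε * ∑ i : Fin N, (S + S) = ENNReal.ofReal (2 * N * ε) * S := by
          rw [ENNReal.ofReal_mul (by positivity), ENNReal.ofReal_mul (by positivity)]
          simp
          ring
        rw [this, ← add_mul, ← ENNReal.ofReal_add h1 (by positivity)]
        simp

/-- The total gain along the Euler scheme is at most the initial value of the Bellman sum, since the
decreases telescope and the final value is nonnegative. -/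
theorem IsConvexWithGain.tsum_stepGain_le {Φ : ℂ → ℂ → ℝ} (hΦ : IsConvexWithGain Φ) (e : G)
    {ε : ℝ} (hε : 0 ≤ ε) (hNε : 2 * N * ε ≤ 1) (f g : (Fin N → G) → ℂ) :
    ∑' k : ℕ, ENNReal.ofReal ε * ∑' n, ENNReal.ofReal
        (stepGain e ε ((heatStep e ε)^[k] f) ((heatStep e ε)^[k] g) n) ≤
      ∑' n, ENNReal.ofReal (Φ (f n) (g n)) := by
  refine ENNReal.tsum_le_of_sum_range_le fun K => ?_
  refine le_trans (le_add_left le_rfl) (?_ : ∑' n, ENNReal.ofReal (Φ ((heatStep e ε)^[K] f n)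
    ((heatStep e ε)^[K] g n)) + _ ≤ _)
  induction K with
  | zero => simp
  | succ K ih =>
    rw [Finset.sum_range_succ, add_comm (Finset.sum _ _), ← add_assoc,
      Function.iterate_succ_apply', Function.iterate_succ_apply']
    exact (add_le_add_left (hΦ.tsum_heatStep_le e hε hNε _ _) _).trans ih

/-! ### Passage to continuous time -/

/-- The integral over `(0, ∞)` of a step function with steps of length `1 / m`. -/
theorem lintegral_comp_floor_mul {m : ℕ} (hm : 0 < m) (h : ℕ → ℝ≥0∞) :
    ∫⁻ t in Set.Ioi (0 : ℝ), h ⌊t * m⌋₊ = ∑' k, ENNReal.ofReal (1 / m) * h k := by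
  have hm' : (0 : ℝ) < m := by exact_mod_cast hm
  have hI : ∀ (k : ℕ) (t : ℝ), t ∈ Set.Ico ((k : ℝ) / m) ((k + 1) / m) ↔
      0 ≤ t ∧ ⌊t * m⌋₊ = k := by
    intro k t
    rw [Set.mem_Ico, div_le_iff₀ hm', lt_div_iff₀ hm']
    constructor
    · rintro ⟨h1, h2⟩
      have : 0 ≤ t * m := le_trans (by positivity) h1
      exact ⟨nonneg_of_mul_nonneg_left this hm', (Nat.floor_eq_iff this).2 ⟨h1, h2⟩⟩
    · rintro ⟨h1, h2⟩
      exact (Nat.floor_eq_iff (by positivity)).1 h2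
  have hU : ⋃ k : ℕ, Set.Ico ((k : ℝ) / m) ((k + 1) / m) = Set.Ici 0 := by
    ext t
    simp only [Set.mem_iUnion, hI, Set.mem_Ici]
    exact ⟨fun ⟨_, h, _⟩ => h, fun h => ⟨_, h, rfl⟩⟩
  rw [← setLIntegral_congr (Ioi_ae_eq_Ici (a := (0 : ℝ))).symm, ← hU,
    lintegral_iUnion (fun _ => measurableSet_Ico)]
  · refine tsum_congr fun k => ?_
    rw [setLIntegral_congr_fun measurableSet_Ico
      (fun t ht => by rw [((hI k t).1 ht).2] : Set.EqOn _ (fun _ => h k) _),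
      setLIntegral_const, Real.volume_Ico, mul_comm, ← sub_div, add_sub_cancel_left]
  · intro j k hjk
    rw [Function.onFun, Set.disjoint_left]
    intro t h1 h2
    exact hjk (((hI j t).1 h1).2.symm.trans ((hI k t).1 h2).2)

theorem measurable_comp_floor_mul {β : Type*} [MeasurableSpace β] (m : ℕ) (h : ℕ → β) :
    Measurable fun t : ℝ => h ⌊t * m⌋₊ :=
  measurable_from_nat.comp (Nat.measurable_floor.comp (measurable_id.mul_const _))

theorem aemeasurable_heatExtension (e : G) {f : (Fin N → G) → ℂ} {C : ℝ} (hf : ∀ n, ‖f n‖ ≤ C)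
    (n : Fin N → G) :
    AEMeasurable (heatExtension e f n) (volume.restrict (Set.Ioi (0 : ℝ))) := by
  refine aemeasurable_of_tendsto_metrizable_ae atTop
    (f := fun (m : ℕ) (t : ℝ) => (heatStep e (1 / m))^[⌊t * m⌋₊] f n)
    (fun m => (measurable_comp_floor_mul m fun k =>
      (heatStep e (1 / m))^[k] f n).aemeasurable) ?_
  filter_upwards [ae_restrict_mem measurableSet_Ioi] with t ht
  exact tendsto_heatStep_iterate e hf ht n

/-- The space-time integral of the limiting gain, obtained from the Euler scheme by Fatou's
lemma. -/
theorem IsConvexWithGain.sum_lintegral_le {Φ : ℂ → ℂ → ℝ} (hΦ : IsConvexWithGain Φ) (e : G)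
    {f g : (Fin N → G) → ℂ} {C D : ℝ} (hf : ∀ n, ‖f n‖ ≤ C) (hg : ∀ n, ‖g n‖ ≤ D)
    (s : Finset (Fin N → G)) :
    ∫⁻ t in Set.Ioi (0 : ℝ), ∑ n ∈ s, ENNReal.ofReal (stepGain e 0
        (fun n => heatExtension e f n t) (fun n => heatExtension e g n t) n) ≤
      ∑' n, ENNReal.ofReal (Φ (f n) (g n)) := by
  set F : ℕ → ℝ → ℝ≥0∞ := fun m t => ∑ n ∈ s, ENNReal.ofReal (stepGain e (1 / m)
    ((heatStep e (1 / m))^[⌊t * m⌋₊] f) ((heatStep e (1 / m))^[⌊t * m⌋₊] g) n) with hF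
  have hlim : ∀ t ∈ Set.Ioi (0 : ℝ), Tendsto (fun m => F m t) atTop
      (𝓝 (∑ n ∈ s, ENNReal.ofReal (stepGain e 0
        (fun n => heatExtension e f n t) (fun n => heatExtension e g n t) n))) := by
    intro t ht
    have a1 := tendsto_heatStep_iterate e hf ht
    have a2 := tendsto_heatStep_iterate e hg ht
    have b1 := tendsto_heatStep_iterate_succ e hf ht
    have b2 := tendsto_heatStep_iterate_succ e hg ht
    refine tendsto_finsetSum _ fun n _ => (ENNReal.continuous_ofReal.tendsto _).comp ?_
    unfold stepGain
    have e0 : ∀ u : (Fin N → G) → ℂ, heatStep e 0 u n = u n := fun u => by simp [heatStep]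
    simp only [e0]
    exact tendsto_finsetSum _ fun i _ =>
      ((((a1 _).sub (b1 n)).norm).mul (((a2 _).sub (b2 n)).norm)).add
        ((((a1 _).sub (b1 n)).norm).mul (((a2 _).sub (b2 n)).norm))
  calc _ = ∫⁻ t in Set.Ioi (0 : ℝ), liminf (fun m => F m t) atTop :=
        setLIntegral_congr_fun measurableSet_Ioi fun t ht => (hlim t ht).liminf_eq.symm
    _ ≤ liminf (fun m => ∫⁻ t in Set.Ioi (0 : ℝ), F m t) atTop :=
        lintegral_liminf_le fun m => measurable_comp_floor_mul m fun k =>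
          ∑ n ∈ s, ENNReal.ofReal (stepGain e (1 / m)
            ((heatStep e (1 / m))^[k] f) ((heatStep e (1 / m))^[k] g) n)
    _ ≤ liminf (fun _ => ∑' n, ENNReal.ofReal (Φ (f n) (g n))) (atTop : Filter ℕ) := by
        refine liminf_le_liminf ?_
        filter_upwards [eventually_ge_atTop (2 * N + 1)] with m hm
        have hm0 : 0 < m := by omega
        have hm' : (0 : ℝ) < m := by exact_mod_cast hm0
        have hN : 2 * (N : ℝ) * (1 / m) ≤ 1 := by
          rw [mul_one_div, div_le_one hm']
          exact_mod_cast (by omega : 2 * N ≤ m)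
        refine le_trans (le_of_eq (lintegral_comp_floor_mul hm0 fun k =>
          ∑ n ∈ s, ENNReal.ofReal (stepGain e (1 / m)
            ((heatStep e (1 / m))^[k] f) ((heatStep e (1 / m))^[k] g) n))) ?_
        refine le_trans (ENNReal.tsum_le_tsum fun k => ?_)
          (hΦ.tsum_stepGain_le e (by positivity) hN f g)
        gcongr
        exact ENNReal.sum_le_tsum s
    _ = _ := liminf_const _

end Discretisation

/-! ### The bilinear estimate -/

theorem exists_bound_of_finite_support {α : Type*} {f : α → ℂ} (hf : f.support.Finite) :
    ∃ C, ∀ n, ‖f n‖ ≤ C := by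
  obtain ⟨C, hC⟩ := (hf.image fun n => ‖f n‖).bddAbove
  refine ⟨max C 0, fun n => ?_⟩
  by_cases h : f n = 0
  · simp [h]
  · exact le_max_of_le_left (hC ⟨n, h, rfl⟩)

/-- For a finitely supported nonzero `f` the `ℓ^p` norm is a positive real number `a`, and the
`p`-th powers of `‖f n‖ / a` sum to `1`. -/
theorem exists_ellNorm_eq {G : Type*} {N : ℕ} {p : ℝ} (hp : 0 < p)
    {f : (Fin N → G) → ℂ} (hf : f.support.Finite)
    (hf0 : f ≠ 0) :
    ∃ a : ℝ, 0 < a ∧ ellNorm p f = ENNReal.ofReal a ∧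
      ∑' n, ENNReal.ofReal (‖a⁻¹ • f n‖ ^ p) = 1 := by
  set S := ∑' n, ‖f n‖ₑ ^ p with hS
  have hStop : S ≠ ∞ := by
    rw [hS, tsum_eq_sum (s := hf.toFinset) fun n hn => by
      simp only [Set.Finite.mem_toFinset, Function.mem_support, not_not] at hn
      simp [hn, hp]]
    exact ENNReal.sum_ne_top.2 fun n _ => ENNReal.rpow_ne_top_of_nonneg hp.le enorm_ne_top
  have hS0 : S ≠ 0 := by
    obtain ⟨n, hn⟩ := Function.ne_iff.1 hf0
    rw [hS, ne_eq, ENNReal.tsum_eq_zero]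
    intro h
    have := h n
    rw [ENNReal.rpow_eq_zero_iff_of_pos hp, enorm_eq_zero] at this
    exact hn this
  have hatop : S ^ (1 / p) ≠ ∞ := ENNReal.rpow_ne_top_of_nonneg (by positivity) hStop
  have ha0 : S ^ (1 / p) ≠ 0 := by
    rw [ne_eq, ENNReal.rpow_eq_zero_iff_of_pos (by positivity)]
    exact hS0
  have hapos : 0 < (S ^ (1 / p)).toReal := ENNReal.toReal_pos ha0 hatop
  have haS : ENNReal.ofReal (S ^ (1 / p)).toReal = S ^ (1 / p) := ENNReal.ofReal_toReal hatop
  refine ⟨(S ^ (1 / p)).toReal, hapos, haS.symm, ?_⟩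
  generalize (S ^ (1 / p)).toReal = a at *
  have hSa : ENNReal.ofReal a ^ p = S := by
    rw [haS, ← ENNReal.rpow_mul, one_div_mul_cancel hp.ne', ENNReal.rpow_one]
  have hterm : ∀ n, ENNReal.ofReal (‖a⁻¹ • f n‖ ^ p) = (ENNReal.ofReal a ^ p)⁻¹ * ‖f n‖ₑ ^ p := by
    intro n
    rw [norm_smul, norm_inv, Real.norm_of_nonneg hapos.le,
      ← ENNReal.ofReal_rpow_of_nonneg (by positivity) hp.le,
      ENNReal.ofReal_mul (by positivity), ENNReal.mul_rpow_of_nonneg _ _ hp.le,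
      ENNReal.ofReal_inv_of_pos hapos, ENNReal.inv_rpow, ofReal_norm]
  simp only [hterm]
  rw [ENNReal.tsum_mul_left, ← hS, hSa, ENNReal.inv_mul_cancel hS0 hStop]

section Integration
variable {G : Type*} [AddCommGroup G] {N : ℕ}

theorem countable_of_zmultiples_eq_top {e : G} (he : AddSubgroup.zmultiples e = ⊤) :
    Countable G :=
  Function.Surjective.countable (f := fun k : ℤ => k • e) fun x =>
    AddSubgroup.mem_zmultiples_iff.1 (he ▸ AddSubgroup.mem_top x)

/-- At `ε = 0` the gain is the sum of the products of differences over all edges at `n`. -/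
theorem ofReal_stepGain_zero (e : G) (u v : (Fin N → G) → ℂ) (n : Fin N → G) :
    ENNReal.ofReal (stepGain e 0 u v n) =
      ∑ i, (‖rightDeriv e i u n‖ₑ * ‖rightDeriv e i v n‖ₑ +
        ‖rightDeriv e i u (n - Pi.single i e)‖ₑ * ‖rightDeriv e i v (n - Pi.single i e)‖ₑ) := by
  unfold stepGain
  rw [ENNReal.ofReal_sum_of_nonneg fun i _ => by positivity]
  refine Finset.sum_congr rfl fun i _ => ?_
  have h0 : ∀ w : (Fin N → G) → ℂ, heatStep e 0 w n = w n := fun w => by simp [heatStep]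
  rw [ENNReal.ofReal_add (by positivity) (by positivity),
    ENNReal.ofReal_mul (norm_nonneg _), ENNReal.ofReal_mul (norm_nonneg _)]
  simp only [h0, ofReal_norm, rightDeriv, sub_add_cancel]
  simp only [← enorm_neg (u n - _), ← enorm_neg (v n - _), neg_sub]

/-- Over a finite set of sites each edge in direction `i` is counted from both of its ends; summed
over the whole group this doubles the energy. -/
theorem two_mul_sum_lintegral_le [Countable G] (e : G) {μ : Measure ℝ}
    {a : Fin N → (Fin N → G) → ℝ → ℝ≥0∞} (ha : ∀ i n, AEMeasurable (a i n) μ) {R : ℝ≥0∞}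
    (hR : ∀ s : Finset (Fin N → G),
      ∫⁻ t, ∑ n ∈ s, ∑ i, (a i n t + a i (n - Pi.single i e) t) ∂μ ≤ R) :
    2 * ∑ i, ∫⁻ t, ∑' n, a i n t ∂μ ≤ R := by
  have hshift : ∀ i : Fin N, ∑' n : Fin N → G,
      ∫⁻ t, a i (n - Pi.single i e) t ∂μ = ∑' n, ∫⁻ t, a i n t ∂μ := fun i =>
    (Equiv.subRight (Pi.single i e : Fin N → G)).tsum_eq fun n => ∫⁻ t, a i n t ∂μ
  have hadd : ∀ i n, AEMeasurable (fun t => a i n t + a i (n - Pi.single i e) t) μ :=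
    fun i n => (ha i n).add (ha i _)
  calc 2 * ∑ i, ∫⁻ t, ∑' n, a i n t ∂μ
      = ∑ i, (∑' n, ∫⁻ t, a i n t ∂μ + ∑' n : Fin N → G, ∫⁻ t, a i (n - Pi.single i e) t ∂μ) := by
        rw [Finset.mul_sum]
        refine Finset.sum_congr rfl fun i _ => ?_
        rw [hshift, lintegral_tsum (ha i), two_mul]
    _ = ∑' n, ∑ i, ∫⁻ t, (a i n t + a i (n - Pi.single i e) t) ∂μ := by
        rw [Summable.tsum_finsetSum fun _ _ => ENNReal.summable]
        refine Finset.sum_congr rfl fun i _ => ?_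
        rw [← ENNReal.tsum_add]
        exact tsum_congr fun n => (lintegral_add_left' (ha i n) _).symm
    _ ≤ R := by
        rw [ENNReal.tsum_eq_iSup_sum]
        refine iSup_le fun s => (le_of_eq ?_).trans (hR s)
        rw [lintegral_finsetSum' s fun n _ => Finset.aemeasurable_fun_sum _ fun i _ => hadd i n]
        refine Finset.sum_congr rfl fun n _ => ?_
        rw [lintegral_finsetSum' _ fun i _ => hadd i n]

theorem aemeasurable_rightDeriv_heatExtension (e : G) {f : (Fin N → G) → ℂ} {C : ℝ}
    (hf : ∀ n, ‖f n‖ ≤ C) (i : Fin N) (n : Fin N → G) :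
    AEMeasurable (fun t => rightDeriv e i (fun m => heatExtension e f m t) n)
      (volume.restrict (Set.Ioi (0 : ℝ))) :=
  (aemeasurable_heatExtension e hf _).sub (aemeasurable_heatExtension e hf _)

/-- The bilinear estimate with a general convex `Φ` with gain in place of the norms. -/
theorem IsConvexWithGain.bilinear_le {Φ : ℂ → ℂ → ℝ} (hΦ : IsConvexWithGain Φ) {e : G}
    (he : AddSubgroup.zmultiples e = ⊤) {f g : (Fin N → G) → ℂ} {C D : ℝ}
    (hf : ∀ n, ‖f n‖ ≤ C) (hg : ∀ n, ‖g n‖ ≤ D) :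
    2 * ∑ i : Fin N, ∫⁻ t in Set.Ioi (0 : ℝ), ∑' n : Fin N → G,
        ‖rightDeriv e i (fun m => heatExtension e f m t) n‖ₑ *
          ‖rightDeriv e i (fun m => heatExtension e g m t) n‖ₑ
      ≤ ∑' n, ENNReal.ofReal (Φ (f n) (g n)) := by
  have := countable_of_zmultiples_eq_top he
  refine two_mul_sum_lintegral_le e (fun i n =>
    (aemeasurable_rightDeriv_heatExtension e hf i n).enorm.mul
      (aemeasurable_rightDeriv_heatExtension e hg i n).enorm) fun s => ?_
  simpa only [ofReal_stepGain_zero, Pi.mul_apply] using hΦ.sum_lintegral_le e hf hg s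

theorem heatExtension_zero (e : G) (n : Fin N → G) (t : ℝ) :
    heatExtension e (0 : (Fin N → G) → ℂ) n t = 0 := by
  have : ∀ k, (discreteLaplacian e)^[k] (0 : (Fin N → G) → ℂ) = 0 := fun k =>
    Function.iterate_fixed (map_zero (laplacianEnd e)) k
  simp [heatExtension, this]

theorem bilinear_le_of_two_le {e : G} (he : AddSubgroup.zmultiples e = ⊤) {p q : ℝ}
    (hpq : p.HolderConjugate q) (hp : 2 ≤ p) {f g : (Fin N → G) → ℂ} (hf : f.support.Finite)
    (hg : g.support.Finite) :
    2 * ∑ i : Fin N, ∫⁻ t in Set.Ioi (0 : ℝ), ∑' n : Fin N → G,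
        ‖rightDeriv e i (fun m => heatExtension e f m t) n‖ₑ *
          ‖rightDeriv e i (fun m => heatExtension e g m t) n‖ₑ
      ≤ ENNReal.ofReal (p - 1) * ellNorm p f * ellNorm q g := by
  rcases eq_or_ne f 0 with rfl | hf0
  · simp [rightDeriv, heatExtension_zero]
  rcases eq_or_ne g 0 with rfl | hg0
  · simp [rightDeriv, heatExtension_zero]
  have hp0 := hpq.pos
  have hq0 := hpq.symm.pos
  have hp1 : 0 ≤ p - 1 := by linarith
  obtain ⟨C, hC⟩ := exists_bound_of_finite_support hf
  obtain ⟨D, hD⟩ := exists_bound_of_finite_support hg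
  obtain ⟨a, ha, hfa, hfsum⟩ := exists_ellNorm_eq hp0 hf hf0
  obtain ⟨b, hb, hgb, hgsum⟩ := exists_ellNorm_eq hq0 hg hg0
  obtain ⟨Φ, hΦ, hΦle⟩ := exists_bellman hpq hp
  refine ((hΦ.rescale ha hb).bilinear_le he hC hD).trans ?_
  calc ∑' n, ENNReal.ofReal (a * b * Φ (a⁻¹ • f n) (b⁻¹ • g n))
      ≤ ∑' n, (ENNReal.ofReal (a * b * (p - 1) * p⁻¹) * ENNReal.ofReal (‖a⁻¹ • f n‖ ^ p) +
          ENNReal.ofReal (a * b * (p - 1) * q⁻¹) * ENNReal.ofReal (‖b⁻¹ • g n‖ ^ q)) := by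
        refine ENNReal.tsum_le_tsum fun n => ?_
        rw [← ENNReal.ofReal_mul (by positivity), ← ENNReal.ofReal_mul (by positivity),
          ← ENNReal.ofReal_add (by positivity) (by positivity)]
        refine ENNReal.ofReal_le_ofReal ?_
        refine (mul_le_mul_of_nonneg_left (hΦle _ _) (by positivity)).trans (le_of_eq ?_)
        ring
    _ = ENNReal.ofReal (a * b * (p - 1) * (p⁻¹ + q⁻¹)) := by
        rw [ENNReal.tsum_add, ENNReal.tsum_mul_left, ENNReal.tsum_mul_left, hfsum, hgsum,
          mul_one, mul_one, ← ENNReal.ofReal_add (by positivity) (by positivity), ← mul_add]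
    _ = ENNReal.ofReal (p - 1) * ellNorm p f * ellNorm q g := by
        rw [hpq.inv_add_inv_eq_one, mul_one, hfa, hgb, ← ENNReal.ofReal_mul hp1,
          ← ENNReal.ofReal_mul (by positivity)]
        congr 1
        ring

end Integration

theorem theorem3 {G : Type*} [AddCommGroup G] (e : G) (he : AddSubgroup.zmultiples e = ⊤)
    (N : ℕ) (p q : ℝ) (hpq : p.HolderConjugate q)
    (f g : (Fin N → G) → ℂ) (hf : f.support.Finite) (hg : g.support.Finite) :
    2 * ∑ i : Fin N, ∫⁻ t in Set.Ioi (0 : ℝ), ∑' n : Fin N → G,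
        ‖rightDeriv e i (fun m => heatExtension e f m t) n‖ₑ *
          ‖rightDeriv e i (fun m => heatExtension e g m t) n‖ₑ
      ≤ ENNReal.ofReal (max p q - 1) * ellNorm p f * ellNorm q g := by
  have hp1 := hpq.lt
  have hq1 := hpq.symm.lt
  have hmul : p * q = p + q := hpq.mul_eq_add
  rcases le_total q p with h | h
  · rw [max_eq_left h]
    exact bilinear_le_of_two_le he hpq (by nlinarith) hf hg
  · rw [max_eq_right h]
    have := bilinear_le_of_two_le he hpq.symm (by nlinarith) hg hf
    simp only [mul_comm ‖rightDeriv e _ (fun m => heatExtension e g m _) _‖ₑ] at this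
    rwa [mul_right_comm] at this
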